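/- Let $R$ be a finite commutative local ring with identity that is not a field, with radical $\operatorname{rad}(R)$ and residue field $\mathbb F=R/\operatorname{rad}(R)$, and let $K\le R^\times$ be a subgroup. Let $\mathcal C=\operatorname{Cyc}(K,R)$ be the cyclotomic scheme on $R$ whose basis relations are the sets $\{(x,y)\in R\times R:\ y-x\in rK\}$, $r\in R$. Its automorphism group $\operatorname{Aut}(\mathcal C)$ consists of the permutations of $R$ that map each basis relation onto itself. The scheme $\mathcal C$ is called normal if $\operatorname{Aut}(\mathcal C)\le \mathrm{A\Gamma L}_1(R)$, the group of all permutations $x\mapsto a\,\sigma(x)+b$ with $a\in R^\times$, $b\in R$ and $\sigma$ a ring automorphism of $R$. For a commutative ring $S$ put $I_0(S)=\{x\in\operatorname{rad}(S):\ x\operatorname{rad}(S)=\{0\}\}$. A subgroup $L\le S^\times$ is called pure if $\{0\}$ is the only ideal $I$ of $S$ with $L+I=L$. For finite local $S$, strong purity is defined recursively: $L\le S^\times$ is strongly pure if $L$ is pure and, unless $S$ is a field, the image of $L$ in $(S/I_0(S))^\times$ is strongly pure. Suppose that $K$ is strongly pure. Then the scheme $\operatorname{Cyc}(K,R)$ is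 normal. Moreover, the natural group homomorphism $\operatorname{Aut}_{\mathcal C}(R)\to\operatorname{Aut}_{\mathcal C}(\mathbb F)$, which sends an automorphism of $R$ to the automorphism it induces on $\mathbb F$, is injective. Here $\operatorname{Aut}_{\mathcal C}(R)$ is the group of ring automorphisms of $R$ lying in $\operatorname{Aut}(\mathcal C)$, and $\operatorname{Aut}_{\mathcal C}(\mathbb F)$ is the group of field automorphisms of $\mathbb F$ that map onto itself each basis relation of the factor-scheme of $\mathcal C$ on $\mathbb F$, i.e. each of the images in $\mathbb F\times\mathbb F$ of the basis relations of $\mathcal C$. -/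

import Mathlib

namespace CycScheme

open scoped Pointwise

universe u v

/-! ### Relational structures, automorphisms, factors -/

/-- The automorphism group of a family `C` of binary relations on `V`
(the basis relations of a scheme): all permutations `f` of `V` with `S ^ f = S` for every `S` in
the family, where `S ^ f = {(f x, f y) : (x, y) ∈ S}`. -/
def schemeAut {V : Type u} (C : Set (Set (V × V))) : Subgroup (Equiv.Perm V) where
  carrier := {f | ∀ S ∈ C, Prod.map f f '' S = S}
  one_mem' := by
    intro S _
    ext ⟨x, y⟩
    simp
  mul_mem' := by
    intro f g hf hg S hS
    have h : (Prod.map (f * g) (f * g) : V × V → V × V) = Prod.map f f ∘ Prod.map g g := by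
      ext p <;> rfl
    change Prod.map (f * g) (f * g) '' S = S
    rw [h, Set.image_comp, hg S hS, hf S hS]
  inv_mem' := by
    intro f hf S hS
    have h : (Prod.map (f⁻¹ : Equiv.Perm V) (f⁻¹ : Equiv.Perm V) : V × V → V × V) ∘
        Prod.map f f = id := by
      ext p <;> simp
    change Prod.map (f⁻¹ : Equiv.Perm V) (f⁻¹ : Equiv.Perm V) '' S = S
    conv_lhs => rw [← hf S hS]
    rw [← Set.image_comp, h, Set.image_id]

/-- The factor of a family `C` of binary relations along a map `π : V → W`. For surjective `π` with
fibre equivalence `E`, so that `W = V / E`, it consists of the relations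
`S_{V/E} = {(X, Y) : S ∩ (X × Y) ≠ ∅}` with `S ∈ C`. -/
def factorScheme {V : Type u} {W : Type v} (π : V → W) (C : Set (Set (V × V))) :
    Set (Set (W × W)) :=
  {T | ∃ S ∈ C, T = {p | ∃ x y, (x, y) ∈ S ∧ π x = p.1 ∧ π y = p.2}}

/-! ### Cyclotomic schemes and normality -/

/-- The subgroup `K` of `Rˣ`, as a subset of `R`. -/
def unitSet {R : Type u} [CommRing R] (K : Subgroup Rˣ) : Set R :=
  {x | ∃ k ∈ K, (k : R) = x}

/-- The cyclotomic scheme `Cyc(K, R)`, given by its basis relations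
`{(x, y) : y - x ∈ r K}`, `r ∈ R`. -/
def cyc {R : Type u} [CommRing R] (K : Subgroup Rˣ) : Set (Set (R × R)) :=
  {S | ∃ r : R, S = {p | p.2 - p.1 ∈ r • unitSet K}}

/-- The group `AΓL₁(R)` of all permutations `x ↦ a * σ x + b` of `R`, where `a` is a unit, `b ∈ R`
and `σ` is a ring automorphism of `R`. -/
def affineSemilinear (R : Type u) [CommRing R] : Subgroup (Equiv.Perm R) where
  carrier := {f | ∃ (a : Rˣ) (b : R) (σ : RingAut R), ∀ x, f x = a * σ x + b}
  one_mem' := ⟨1, 0, 1, fun x => by simp⟩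
  mul_mem' := by
    rintro f g ⟨a, b, σ, hf⟩ ⟨c, d, τ, hg⟩
    refine ⟨a * Units.map (σ : R →* R) c, a * σ d + b, σ * τ, fun x => ?_⟩
    simp only [Equiv.Perm.mul_apply, hf, hg, map_add, map_mul, RingAut.mul_apply, Units.val_mul,
      Units.coe_map]
    simp only [MonoidHom.coe_coe]
    ring
  inv_mem' := by
    rintro f ⟨a, b, σ, hf⟩
    refine ⟨Units.map (σ.symm : R →* R) a⁻¹, -(σ.symm ((a⁻¹ : Rˣ) * b)), σ⁻¹, fun x => ?_⟩
    rw [Equiv.Perm.inv_eq_iff_eq, hf]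
    simp only [Units.coe_map, MonoidHom.coe_coe, RingAut.inv_apply, map_add, map_mul, map_neg,
      RingEquiv.apply_symm_apply, mul_add, mul_neg, Units.mul_inv_cancel_left]
    ring

/-- A cyclotomic scheme (given by its basis relations) over `R` is normal if its automorphism
group is contained in `AΓL₁(R)`. -/
def IsNormalScheme {R : Type u} [CommRing R] (C : Set (Set (R × R))) : Prop :=
  schemeAut C ≤ affineSemilinear R

/-! ### Pure and strongly pure groups -/

/-- `K` is pure if the zero ideal is the only ideal `I` with `K + I = K`. -/
def IsPure {R : Type u} [CommRing R] (K : Subgroup Rˣ) : Prop :=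
  ∀ I : Ideal R, unitSet K + (I : Set R) = unitSet K → I = ⊥

/-- The ideal `I₀ = {x ∈ rad R : x * rad R = 0}`. -/
def I0 (R : Type u) [CommRing R] : Ideal R where
  carrier := {x | x ∈ Ring.jacobson R ∧ ∀ y ∈ Ring.jacobson R, x * y = 0}
  zero_mem' := ⟨zero_mem _, fun y _ => zero_mul y⟩
  add_mem' := by
    rintro x z ⟨hx, hx'⟩ ⟨hz, hz'⟩
    exact ⟨add_mem hx hz, fun y hy => by rw [add_mul, hx' y hy, hz' y hy, add_zero]⟩
  smul_mem' := by
    rintro c x ⟨hx, hx'⟩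
    exact ⟨Ideal.mul_mem_left _ c hx, fun y hy => by
      rw [smul_eq_mul, mul_assoc, hx' y hy, mul_zero]⟩

/-- The image of `K ≤ Rˣ` in the unit group of `R / I`. -/
def imageQuot {R : Type u} [CommRing R] (I : Ideal R) (K : Subgroup Rˣ) : Subgroup (R ⧸ I)ˣ :=
  K.map (Units.map (Ideal.Quotient.mk I : R →* R ⧸ I))

/-- `K ≤ Rˣ` is strongly pure if it is pure and, unless `R` is a field, its image in `R / I₀` is
strongly pure. (For a finite local ring that is not a field, `I₀ ≠ 0`, so that the recursion
terminates.) -/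
inductive IsStronglyPure : ∀ {R : Type u} [CommRing R], Subgroup Rˣ → Prop
  | intro {R : Type u} [CommRing R] {K : Subgroup Rˣ} (pure : IsPure K)
      (quot : ¬ IsField R → IsStronglyPure (imageQuot (I0 R) K)) : IsStronglyPure K

theorem isStronglyPure_iff {R : Type u} [CommRing R] (K : Subgroup Rˣ) :
    IsStronglyPure K ↔ IsPure K ∧ (¬ IsField R → IsStronglyPure (imageQuot (I0 R) K)) :=
  ⟨fun h => by cases h with | intro h1 h2 => exact ⟨h1, h2⟩, fun h => .intro h.1 h.2⟩

/-! ### Ring automorphisms preserving a scheme -/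

/-- `Aut_C(A) = Aut(C) ∩ Aut(A)`: the ring automorphisms of `A` that are automorphisms of the
scheme `C` on `A`. -/
def ringSchemeAut {A : Type u} [CommRing A] (C : Set (Set (A × A))) : Subgroup (RingAut A) :=
  (schemeAut C).comap (RingAut.toPerm A)

/-- The factor of the scheme `C` on the residue field of the local ring `R`. -/
def residueScheme {R : Type u} [CommRing R] [IsLocalRing R] (C : Set (Set (R × R))) :
    Set (Set (IsLocalRing.ResidueField R × IsLocalRing.ResidueField R)) :=
  factorScheme (IsLocalRing.residue R) C

theorem mapAut_mem {R : Type u} [CommRing R] [IsLocalRing R] (C : Set (Set (R × R)))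
    (σ : RingAut R) (hσ : σ ∈ ringSchemeAut C) :
    IsLocalRing.ResidueField.mapAut σ ∈ ringSchemeAut (residueScheme C) := by
  have key : ∀ x : R, IsLocalRing.ResidueField.mapAut σ (IsLocalRing.residue R x) =
      IsLocalRing.residue R (σ x) := fun x => rfl
  rintro T ⟨S, hS, rfl⟩
  have h : Prod.map σ σ '' S = S := hσ S hS
  change Prod.map (IsLocalRing.ResidueField.mapAut σ) (IsLocalRing.ResidueField.mapAut σ) '' _ = _
  ext ⟨p, q⟩
  constructor
  · rintro ⟨⟨p', q'⟩, ⟨x, y, hxy, rfl, rfl⟩, he⟩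
    obtain ⟨rfl, rfl⟩ := Prod.ext_iff.1 he
    exact ⟨σ x, σ y, h ▸ ⟨(x, y), hxy, rfl⟩, (key x).symm, (key y).symm⟩
  · rintro ⟨x, y, hxy, rfl, rfl⟩
    rw [← h] at hxy
    obtain ⟨⟨x', y'⟩, hxy', he⟩ := hxy
    obtain ⟨rfl, rfl⟩ := Prod.ext_iff.1 he
    exact ⟨(IsLocalRing.residue R x', IsLocalRing.residue R y'), ⟨x', y', hxy', rfl, rfl⟩,
      Prod.ext (key x') (key y')⟩

/-- The natural homomorphism from `Aut_C(R)` to `Aut_C(𝔽)`, sending `σ` to the automorphism it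
induces on the residue field `𝔽`. -/
noncomputable def residueAutHom {R : Type u} [CommRing R] [IsLocalRing R]
    (C : Set (Set (R × R))) : ringSchemeAut C →* ringSchemeAut (residueScheme C) :=
  (IsLocalRing.ResidueField.mapAut.comp (ringSchemeAut C).subtype).codRestrict _
    fun σ => mapAut_mem C σ σ.2

end CycScheme

namespace CycScheme

/-! Write `A` for the additive group of all u ∈ I₀ with 1 + u ∈ K. Purity means that `A` contains no
nonzero ideal. An automorphism of the scheme is a map f with f x - f y ∈ (x - y)K, and after an
affine change f 0 = 0 and f 1 = 1. Such maps descend to R/I₀, so f is shown to be a ring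
homomorphism by induction along R → R/I₀.

Inductive step (`IsCycMap.map_add_and_map_mul`): if f is a homomorphism modulo I₀, then x ↦ f (x +
y) and x ↦ f x + f y agree modulo I₀. By rigidity (`IsCycMap.eq_affine_of_sub_mem_I0`) such maps
differ by an affine map with slope in 1 + `A`, and symmetry in x and y puts a whole principal ideal
into `A`, so the discrepancy vanishes. Rigidity reduces by finite differences to additive maps F →
I₀, which linear independence of characters of Fˣ shows to be linear.

Base case: purity says nothing over a field, so the induction stops when F = R/I₀ is a field, while
I₀ ≠ 0 still carries information. Comparing f on I₀ and at r⁻¹ shows that s ↦ h(s⁻¹)⁻¹ is additive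
for the induced map h on F (`IsCycMap.inv_additive`). The same holds around 1, and Hua's identity
makes h a field automorphism.

Injectivity is rigidity against the identity map, by the same induction. -/

/-! ### Hua's theorem over fields. -/

/-- A form of Hua's identity: if inversion conjugates `h` to an additive map around `0` and
around `1`, then `h` is additive. -/
theorem hua_additive {F : Type*} [Field F] {h : F → F} (hinj : Function.Injective h)
    (h0 : h 0 = 0) (h1 : h 1 = 1)
    (hG : ∀ s t, (h (s + t)⁻¹)⁻¹ = (h s⁻¹)⁻¹ + (h t⁻¹)⁻¹)
    (hH : ∀ s t, (h (1 + (s + t)⁻¹) - 1)⁻¹ = (h (1 + s⁻¹) - 1)⁻¹ + (h (1 + t⁻¹) - 1)⁻¹)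
    (x y : F) : h (x + y) = h x + h y := by
  have key : ∀ s, (h (1 + s⁻¹) - 1)⁻¹ = h (s + 1) - 1 := by
    intro s
    rcases eq_or_ne s 0 with rfl | hs
    · simp [h1]
    by_cases hs1 : s + 1 = 0
    · obtain rfl : s = -1 := by linear_combination hs1
      norm_num [h0]
    -- The arguments sum to 1, and the first is the inverse of 1 + s⁻¹; this expresses h (1 + s⁻¹)
    -- through h (s + 1).
    have e := hG (1 - (s + 1)⁻¹) (s + 1)⁻¹
    have e1 : (1 - (s + 1)⁻¹)⁻¹ = 1 + s⁻¹ := by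
      have : 1 - (s + 1)⁻¹ = s / (s + 1) := by field_simp; ring
      rw [this]; field_simp
    rw [sub_add_cancel, inv_one, h1, inv_one, inv_inv, e1] at e
    have hne : h (s + 1) ≠ 0 := fun h' => hs1 (hinj (h'.trans h0.symm))
    have hne1 : h (s + 1) - 1 ≠ 0 := fun h' => hs (by
      have := hinj ((sub_eq_zero.1 h').trans h1.symm)
      linear_combination this)
    have e2 : (h (1 + s⁻¹))⁻¹ = (h (s + 1) - 1) / h (s + 1) := by
      rw [sub_div, div_self hne, one_div]; linear_combination -e
    have e3 : h (1 + s⁻¹) = h (s + 1) / (h (s + 1) - 1) := by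
      rw [← inv_inv (h (1 + s⁻¹)), e2, inv_div]
    rw [e3]
    field_simp
    ring
  have step : ∀ s t, h (s + t + 1) = h (s + 1) + h (t + 1) - 1 := by
    intro s t
    have := hH s t
    rw [key, key, key] at this
    linear_combination this
  have succ : ∀ p, h (p + 1) = h p + 1 := by
    intro p
    have e := step p (-1)
    rw [neg_add_cancel, h0, neg_add_cancel_right] at e
    linear_combination -e
  have := step (x - 1) y
  rw [succ y, sub_add_cancel, show x - 1 + y + 1 = x + y by ring] at this
  linear_combination this

/-- Hua's theorem for a finite field. -/
theorem hua_multiplicative {F : Type*} [Field F] [Finite F] {h : F → F}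
    (hinj : Function.Injective h) (h0 : h 0 = 0) (h1 : h 1 = 1)
    (hadd : ∀ x y, h (x + y) = h x + h y)
    (hG : ∀ s t, (h (s + t)⁻¹)⁻¹ = (h s⁻¹)⁻¹ + (h t⁻¹)⁻¹)
    (x y : F) : h (x * y) = h x * h y := by
  obtain ⟨G, hGdef⟩ : ∃ G : F → F, ∀ s, G s = (h s⁻¹)⁻¹ := ⟨_, fun _ => rfl⟩
  simp only [← hGdef] at hG
  have G0 : G 0 = 0 := by simp [hGdef, h0]
  have G1 : G 1 = 1 := by simp [hGdef, h1]
  have Gne : ∀ {s}, s ≠ 0 → G s ≠ 0 := by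
    intro s hs h'
    rw [hGdef, inv_eq_zero] at h'
    exact hs (inv_eq_zero.1 (hinj (h'.trans h0.symm)))
  have hneg : ∀ s, h (-s) = -h s := by
    intro s
    have := hadd s (-s)
    rw [add_neg_cancel, h0] at this
    linear_combination -this
  have Gneg : ∀ s, G (-s) = -G s := by
    intro s
    have := hG s (-s)
    rw [add_neg_cancel, G0] at this
    linear_combination -this
  have hinv : ∀ w, h w⁻¹ = (G w)⁻¹ := fun w => by rw [hGdef, inv_inv]
  have quad : ∀ a d, a ≠ 0 → d ≠ 0 → G (a ^ 2 / d) = G a ^ 2 / G d := by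
    intro a d ha hd
    by_cases had : a + d = 0
    · obtain rfl : d = -a := by linear_combination had
      have e : a ^ 2 / -a = -a := by field_simp
      have := Gne ha
      rw [e, Gneg]
      field_simp
    have hGad : G a + G d ≠ 0 := by rw [← hG]; exact Gne had
    -- Hua's identity: it writes a² / d through sums and inverses only, and `h` and `G` respect
    -- these jointly.
    have e : (a + a ^ 2 / d)⁻¹ = a⁻¹ + -(a + d)⁻¹ := by
      have : a + a ^ 2 / d = a * (a + d) / d := by field_simp; ring
      rw [this]; field_simp; ring
    have e' := hinv (a + a ^ 2 / d)
    rw [e, hadd, hneg, hinv, hinv, hG, hG] at e'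
    have ga := Gne ha
    have gd := Gne hd
    have e2 : (G a)⁻¹ + -(G a + G d)⁻¹ = G d / (G a * (G a + G d)) := by field_simp; ring
    rw [e2, ← inv_div, inv_inj] at e'
    have e3 : G a * (G a + G d) / G d = G a + G a ^ 2 / G d := by field_simp; ring
    rw [e3] at e'
    linear_combination -e'
  have Gh : ∀ d, G d = h d := by
    intro d
    rcases eq_or_ne d 0 with rfl | hd
    · rw [G0, h0]
    have := quad 1 d one_ne_zero hd
    rw [G1] at this
    rw [← inv_inv (h d), ← inv_inv d, ← hGdef, inv_inv d]
    simp only [one_pow, one_div] at this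
    rw [this, inv_inv]
  have sq : ∀ a e, h (a ^ 2 * e) = h a ^ 2 * h e := by
    intro a e
    rcases eq_or_ne a 0 with rfl | ha
    · simp [h0]
    rcases eq_or_ne e 0 with rfl | he
    · simp [h0]
    have := quad a e⁻¹ ha (inv_ne_zero he)
    rw [div_inv_eq_mul, Gh, Gh, hGdef, inv_inv, div_inv_eq_mul] at this
    exact this
  by_cases h2 : (2 : F) = 0
  · have : ringChar F = 2 := by
      have hd : ringChar F ∣ 2 := (ringChar.spec F 2).1 (by exact_mod_cast h2)
      rcases (Nat.dvd_prime Nat.prime_two).1 hd with h' | h'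
      · exact absurd h' (CharP.ringChar_ne_one)
      · exact h'
    obtain ⟨z, rfl⟩ := FiniteField.isSquare_of_char_two this x
    have e1 := sq z y
    have e2 := sq z 1
    rw [h1, mul_one, mul_one] at e2
    rw [← pow_two, e1, e2]
  -- Polarization: comparing the squares of x + 1 and x isolates 2xy.
  · have e := sq (x + 1) y
    have e1 := sq x y
    have : (x + 1) ^ 2 * y = x ^ 2 * y + (x * y + (x * y + y)) := by ring
    rw [this, hadd, hadd, hadd, hadd, e1, h1] at e
    apply mul_left_cancel₀ h2
    linear_combination e

/-! ### Additive maps on finite fields and independence of characters. -/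

/-- Two quotients of automorphisms agree only in the obvious cases. -/
theorem quotient_of_automorphisms_injective {F : Type*} [Field F] {α γ δ ε : F →+* F} (hne : α ≠ γ)
    (h : ∀ x, α x * ε x = δ x * γ x) : δ = α ∧ ε = γ := by
  have hsum : ∀ x, α x + ε x = δ x + γ x := by
    intro x
    have := h (x + 1)
    simp only [map_add, map_one] at this
    linear_combination this - h x
  have hor : ∀ x, α x = δ x ∨ α x = γ x := by
    intro x
    have : (α x - δ x) * (α x - γ x) = 0 := by
      linear_combination α x * hsum x - h x
    rcases mul_eq_zero.1 this with h' | h'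
    · exact .inl (sub_eq_zero.1 h')
    · exact .inr (sub_eq_zero.1 h')
  obtain ⟨x, hx⟩ : ∃ x, α x ≠ γ x := by
    by_contra! hc
    exact hne (RingHom.ext hc)
  -- An additive group is not the union of two proper subgroups, here the sets where α = δ and where
  -- α = γ.
  have hδ : ∀ y, δ y = α y := by
    intro y
    by_contra hy
    have hy' : α y = γ y := (hor y).resolve_left (Ne.symm hy)
    have hx' : α x = δ x := (hor x).resolve_right hx
    rcases hor (x + y) with e | e
    · rw [map_add, map_add, hx', add_right_inj] at e
      exact hy e.symm
    · rw [map_add, map_add, hy', add_left_inj] at e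
      exact hx e
  refine ⟨RingHom.ext hδ, RingHom.ext fun y => ?_⟩
  have := hsum y
  rw [hδ] at this
  exact add_left_cancel this

/-- A biadditive form on a finite field vanishing on all pairs `(x, x⁻¹)` only depends on the
product of its arguments. -/
theorem biadditive_eq_of_inv {F : Type*} [Field F] [Finite F] {p : ℕ} [Fact p.Prime]
    [Algebra (ZMod p) F] (β : F →ₗ[ZMod p] F →ₗ[ZMod p] F) (hβ : ∀ x, x ≠ 0 → β x x⁻¹ = 0)
    (x y : F) : β x y = β 1 (x * y) := by
  classical
  have : FiniteDimensional (ZMod p) F := Module.Finite.of_finite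
  let e := Module.finBasis (ZMod p) F
  let e' := e.traceDual
  have hexp : ∀ x, x = ∑ i, (algebraMap (ZMod p) F (Algebra.trace (ZMod p) F (x * e' i))) * e i := by
    intro x
    conv_lhs => rw [← e.sum_repr x]
    refine Finset.sum_congr rfl fun i _ => ?_
    rw [Algebra.smul_def]
    congr 2
    have := e'.traceDual_repr_apply x i
    rw [Module.Basis.traceDual_traceDual] at this
    rw [this, Algebra.traceForm_apply]
  -- Coordinates are traces against the dual basis, and traces are sums of conjugates, so β is a
  -- combination of the products σ x * τ y with these coefficients.
  let c : Gal(F/ZMod p) × Gal(F/ZMod p) → F := fun q =>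
    ∑ i, ∑ j, q.1 (e' i) * q.2 (e' j) * β (e i) (e j)
  have hc : ∀ x y, β x y = ∑ q : Gal(F/ZMod p) × Gal(F/ZMod p), c q * (q.1 x * q.2 y) := by
    intro x y
    have h : β x y = ∑ i, ∑ j, (∑ σ : Gal(F/ZMod p), σ (x * e' i)) *
        (∑ τ : Gal(F/ZMod p), τ (y * e' j)) * β (e i) (e j) := by
      conv_lhs => rw [hexp x, hexp y]
      simp only [← Algebra.smul_def, map_sum, map_smul, LinearMap.sum_apply, LinearMap.smul_apply]
      rw [Finset.sum_comm]
      refine Finset.sum_congr rfl fun i _ => ?_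
      rw [Finset.smul_sum]
      refine Finset.sum_congr rfl fun j _ => ?_
      rw [Algebra.smul_def, Algebra.smul_def, trace_eq_sum_automorphisms,
        trace_eq_sum_automorphisms]
      ring
    have h' : ∑ q : Gal(F/ZMod p) × Gal(F/ZMod p), c q * (q.1 x * q.2 y) =
        ∑ i, ∑ j, ∑ q : Gal(F/ZMod p) × Gal(F/ZMod p),
          q.1 (e' i) * q.2 (e' j) * β (e i) (e j) * (q.1 x * q.2 y) := by
      simp only [c, Finset.sum_mul]
      rw [Finset.sum_comm]
      exact Finset.sum_congr rfl fun i _ => Finset.sum_comm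
    rw [h, h']
    refine Finset.sum_congr rfl fun i _ => Finset.sum_congr rfl fun j _ => ?_
    rw [Fintype.sum_prod_type, Finset.sum_mul_sum, Finset.sum_mul]
    refine Finset.sum_congr rfl fun σ _ => ?_
    rw [Finset.sum_mul]
    refine Finset.sum_congr rfl fun τ _ => ?_
    rw [map_mul, map_mul]
    ring
  let χ : Gal(F/ZMod p) × Gal(F/ZMod p) → (Fˣ →* F) := fun q =>
    { toFun := fun u => q.1 u * q.2 ((u⁻¹ : Fˣ) : F)
      map_one' := by simp
      map_mul' := fun u v => by simp only [Units.val_mul, mul_inv, map_mul]; ring }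
  -- All diagonal pairs (σ, σ) give the trivial character, so coefficients are summed over the
  -- fibres of `χ` before independence is applied.
  have hli := linearIndependent_iff'.1 (linearIndependent_monoidHom Fˣ F)
    (Finset.univ.image χ) (fun ψ => ∑ q with χ q = ψ, c q) (by
      have : ∀ ψ ∈ Finset.univ.image χ, (∑ q with χ q = ψ, c q) • (ψ : Fˣ → F) =
          ∑ q with χ q = ψ, c q • (χ q : Fˣ → F) := by
        intro ψ _
        rw [Finset.sum_smul]
        refine Finset.sum_congr rfl fun q hq => ?_
        rw [(Finset.mem_filter.1 hq).2]
      rw [Finset.sum_congr rfl this, Finset.sum_fiberwise_of_maps_to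
        (fun q _ => Finset.mem_image_of_mem χ (Finset.mem_univ q))]
      funext u
      have := hβ u u.ne_zero
      rw [hc] at this
      simpa [χ, Finset.sum_apply] using this)
  have hc0 : ∀ q, q.1 ≠ q.2 → c q = 0 := by
    intro q hq
    have := hli (χ q) (Finset.mem_image_of_mem χ (Finset.mem_univ q))
    rw [Finset.sum_eq_single q] at this
    · exact this
    · intro r hr hrq
      exfalso
      apply hrq
      have hχ := (Finset.mem_filter.1 hr).2
      obtain ⟨h1, h2⟩ := quotient_of_automorphisms_injective (α := (q.1 : F →+* F))
        (γ := (q.2 : F →+* F)) (δ := (r.1 : F →+* F)) (ε := (r.2 : F →+* F))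
        (fun h => hq (AlgEquiv.ext fun x => RingHom.congr_fun h x)) (by
          intro x
          rcases eq_or_ne x 0 with rfl | hx
          · simp
          have := DFunLike.congr_fun hχ (Units.mk0 x hx)
          simp only [χ, MonoidHom.coe_mk, OneHom.coe_mk, Units.val_mk0, Units.val_inv_eq_inv_val,
            map_inv₀] at this
          have hq2 : q.2 x ≠ 0 := by simpa using hx
          have hr2 : r.2 x ≠ 0 := by simpa using hx
          field_simp at this
          change q.1 x * r.2 x = r.1 x * q.2 x
          linear_combination -this)
      exact Prod.ext (AlgEquiv.ext fun x => RingHom.congr_fun h1 x)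
        (AlgEquiv.ext fun x => RingHom.congr_fun h2 x)
    · intro h
      exact absurd (by simp) h
  rw [hc, hc]
  refine Finset.sum_congr rfl fun q _ => ?_
  by_cases hq : q.1 = q.2
  · simp [hq]
  · simp [hc0 q hq]

/-- Let `A` be an additive subgroup of a vector space over a finite field that contains no nonzero
subspace. An additive map `b` with `x⁻¹ • b x ∈ A` for all `x ≠ 0` is linear. -/
theorem addHom_eq_smul_of_mem {F V : Type*} [Field F] [Finite F] [AddCommGroup V] [Module F V]
    (A : AddSubgroup V) (hA : ∀ v, (∀ s : F, s • v ∈ A) → v = 0) (b : F →+ V)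
    (hb : ∀ x, x ≠ 0 → x⁻¹ • b x ∈ A) (x : F) : b x = x • b 1 := by
  obtain ⟨p, hp⟩ := CharP.exists F
  have : Fact p.Prime := ⟨CharP.char_is_prime F p⟩
  let : Algebra (ZMod p) F := ZMod.algebra F p
  let : Module (ZMod p) V := Module.compHom V (algebraMap (ZMod p) F)
  have : IsScalarTower (ZMod p) F V := ⟨fun a s v => by
    rw [Algebra.smul_def, mul_smul]; rfl⟩
  rw [← sub_eq_zero]
  refine hA _ fun s => ?_
  by_contra hs
  -- A functional over the prime field separates the vector from `A`; then β x y = l (y • b x)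
  -- vanishes on all pairs (x, x⁻¹).
  obtain ⟨l, hl, hl'⟩ := Submodule.exists_le_ker_of_notMem (K := ZMod p)
    (p := AddSubgroup.toZModSubmodule p A) (v := s • (b x - x • b 1)) hs
  have hlA : ∀ a ∈ A, l a = 0 := fun a ha => hl' ha
  let β : F →ₗ[ZMod p] F →ₗ[ZMod p] F :=
    AddMonoidHom.toZModLinearMap p
      { toFun := fun x => ((Algebra.linearMap (ZMod p) F).comp l).comp
          ((LinearMap.toSpanSingleton F V (b x)).restrictScalars (ZMod p))
        map_zero' := by ext; simp
        map_add' := fun x y => by ext; simp }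
  have hβ : ∀ x y, β x y = algebraMap (ZMod p) F (l (y • b x)) := fun x y => rfl
  have := biadditive_eq_of_inv β (fun x hx => by rw [hβ, hlA _ (hb x hx), map_zero]) x s
  rw [hβ, hβ] at this
  apply hl
  rw [smul_sub, map_sub, (algebraMap (ZMod p) F).injective this, smul_smul, mul_comm, sub_self]

/-! ### The ideal I₀ and the principal part of K. -/

theorem mem_I0_iff {R : Type*} [CommRing R] [IsLocalRing R] {u : R} :
    u ∈ I0 R ↔ u ∈ IsLocalRing.maximalIdeal R ∧ ∀ y ∈ IsLocalRing.maximalIdeal R, u * y = 0 := by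
  rw [← IsLocalRing.ringJacobson_eq_maximalIdeal]
  exact Iff.rfl

theorem mul_eq_zero_of_mem_I0 {R : Type*} [CommRing R] [IsLocalRing R] {u y : R} (hu : u ∈ I0 R)
    (hy : ¬ IsUnit y) : y * u = 0 := by
  rw [mul_comm]
  exact (mem_I0_iff.1 hu).2 y ((IsLocalRing.mem_maximalIdeal y).2 hy)

theorem not_isUnit_of_mem_I0 {R : Type*} [CommRing R] [IsLocalRing R] {u : R} (hu : u ∈ I0 R) :
    ¬ IsUnit u :=
  (IsLocalRing.mem_maximalIdeal u).1 (mem_I0_iff.1 hu).1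

theorem mul_eq_zero_of_mem_I0_of_mem_I0 {R : Type*} [CommRing R] [IsLocalRing R] {u v : R}
    (hu : u ∈ I0 R) (hv : v ∈ I0 R) : u * v = 0 :=
  mul_eq_zero_of_mem_I0 hv (not_isUnit_of_mem_I0 hu)

/-- The additive group of all `u ∈ I₀` with `1 + u ∈ K`. -/
def principalPart {R : Type*} [CommRing R] [IsLocalRing R] (K : Subgroup Rˣ) : AddSubgroup R where
  carrier := {u | u ∈ I0 R ∧ ∃ k ∈ K, (k : R) = 1 + u}
  zero_mem' := ⟨zero_mem _, 1, one_mem _, by simp⟩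
  add_mem' := by
    rintro u v ⟨hu, k, hk, hku⟩ ⟨hv, l, hl, hlv⟩
    refine ⟨add_mem hu hv, k * l, mul_mem hk hl, ?_⟩
    rw [Units.val_mul, hku, hlv]
    linear_combination mul_eq_zero_of_mem_I0_of_mem_I0 hu hv
  neg_mem' := by
    rintro u ⟨hu, k, hk, hku⟩
    refine ⟨neg_mem hu, k⁻¹, inv_mem hk, ?_⟩
    rw [Units.inv_eq_of_mul_eq_one_right (u := k) (a := 1 + -u)]
    rw [hku]
    linear_combination -mul_eq_zero_of_mem_I0_of_mem_I0 hu hu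

/-- This is the form in which purity is used: if Rv lies in the principal part, then k + av = k(1 +
k⁻¹av) stays in K, so K + Rv = K. -/
theorem eq_zero_of_forall_mul_mem_principalPart {R : Type*} [CommRing R] [IsLocalRing R]
    {K : Subgroup Rˣ} (hK : IsPure K) {v : R} (hv : ∀ s, s * v ∈ principalPart K) : v = 0 := by
  rw [← Ideal.span_singleton_eq_bot]
  apply hK
  ext x
  constructor
  · rintro ⟨_, ⟨k, hk, rfl⟩, y, hy, rfl⟩
    obtain ⟨a, rfl⟩ := Ideal.mem_span_singleton'.1 hy
    obtain ⟨_, l, hl, hlv⟩ := hv (((k⁻¹ : Rˣ) : R) * a)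
    refine ⟨k * l, mul_mem hk hl, ?_⟩
    rw [Units.val_mul, hlv]
    linear_combination a * v * k.mul_inv
  · intro hx
    exact ⟨x, hx, 0, zero_mem _, add_zero x⟩

/-- The radical annihilates I₀, so I₀ is a vector space over the residue field. Once `b` is known to
kill the radical, it descends to the residue field and the vector space version applies. -/
theorem addHom_eq_mul_of_mem {R : Type*} [CommRing R] [Finite R] [IsLocalRing R]
    {A : AddSubgroup R} (hA : ∀ v, (∀ s, s * v ∈ A) → v = 0) (b : R →+ R) (hb : ∀ x, b x ∈ I0 R)
    (hbA : ∀ r, IsUnit r → ∃ a ∈ A, b r = r * a) (x : R) : b x = x * b 1 := by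
  have htors : Module.IsTorsionBySet R (I0 R) (IsLocalRing.maximalIdeal R) := by
    rintro ⟨u, hu⟩ ⟨m, hm⟩
    exact Subtype.ext (mul_eq_zero_of_mem_I0 hu ((IsLocalRing.mem_maximalIdeal m).1 hm))
  let := htors.module
  let : Field (R ⧸ IsLocalRing.maximalIdeal R) := Ideal.Quotient.field _
  have : Finite (R ⧸ IsLocalRing.maximalIdeal R) := Finite.of_surjective _ Ideal.Quotient.mk_surjective
  have hmem : ∀ {r s}, s * r = 1 → s * b r ∈ A := by
    intro r s hsr
    obtain ⟨a, ha, h⟩ := hbA r (IsUnit.of_mul_eq_one s (by rw [mul_comm]; exact hsr))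
    rwa [h, ← mul_assoc, hsr, one_mul]
  have hrad : ∀ m ∈ IsLocalRing.maximalIdeal R, b m = 0 := by
    intro m hm
    refine hA _ fun s => ?_
    by_cases hs : IsUnit s
    · obtain ⟨r, hr⟩ := hs.exists_right_inv
      have hru : IsUnit r := IsUnit.of_mul_eq_one s (by rw [mul_comm]; exact hr)
      have hrm : IsUnit (r + m) := by
        by_contra h
        have := (IsLocalRing.maximalIdeal R).sub_mem ((IsLocalRing.mem_maximalIdeal _).2 h) hm
        rw [add_sub_cancel_right] at this
        exact (IsLocalRing.mem_maximalIdeal _).1 this hru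
      obtain ⟨a, ha, h⟩ := hbA _ hrm
      have haI : a ∈ I0 R := (Submodule.smul_mem_iff_of_isUnit (I0 R) hrm).1
        (by rw [smul_eq_mul, ← h]; exact hb _)
      -- As ma = 0, the slope of b at r + m is s * b (r + m), so s * b m is a difference of two
      -- slopes in `A`.
      have hma := mul_eq_zero_of_mem_I0 haI ((IsLocalRing.mem_maximalIdeal m).1 hm)
      have : s * b m = a - s * b r := by
        rw [map_add] at h
        linear_combination s * h + a * hr + s * hma
      rw [this]
      exact A.sub_mem ha (hmem hr)
    · rw [mul_eq_zero_of_mem_I0 (hb m) hs]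
      exact zero_mem _
  let b' : R ⧸ IsLocalRing.maximalIdeal R →+ I0 R :=
    QuotientAddGroup.lift (IsLocalRing.maximalIdeal R).toAddSubgroup
      (b.codRestrict (I0 R) hb) (fun m hm => Subtype.ext (hrad m hm))
  have hb' : ∀ r, (b' (Ideal.Quotient.mk _ r) : R) = b r := fun r => rfl
  have hsmul : ∀ (r : R) (u : I0 R),
      ((Ideal.Quotient.mk (IsLocalRing.maximalIdeal R) r • u : I0 R) : R) = r * u := fun r u => rfl
  have := addHom_eq_smul_of_mem (A.comap (I0 R).toAddSubgroup.subtype)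
    (fun v hv => Subtype.ext (hA _ fun s =>
      hv (Ideal.Quotient.mk (IsLocalRing.maximalIdeal R) s))) b' (by
      intro y hy
      obtain ⟨r, rfl⟩ := Ideal.Quotient.mk_surjective y
      have hr : IsUnit r := by
        by_contra h
        exact hy (Ideal.Quotient.eq_zero_iff_mem.2 ((IsLocalRing.mem_maximalIdeal r).2 h))
      obtain ⟨s, hs⟩ := hr.exists_left_inv
      have hinv : (Ideal.Quotient.mk (IsLocalRing.maximalIdeal R) r)⁻¹ =
          Ideal.Quotient.mk (IsLocalRing.maximalIdeal R) s :=
        inv_eq_of_mul_eq_one_left (by rw [← map_mul, hs, map_one])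
      rw [hinv]
      exact hmem hs) (Ideal.Quotient.mk _ x)
  have h2 := congrArg Subtype.val this
  rw [← map_one (Ideal.Quotient.mk (IsLocalRing.maximalIdeal R)), hsmul, hb', hb'] at h2
  exact h2

/-! ### Maps with slopes in A are affine. -/

/-- Maps `R → I₀` all of whose slopes over unit distances lie in `A`. -/
def HasSlopesIn {R : Type*} [CommRing R] (A : AddSubgroup R) (b : R → R) : Prop :=
  (∀ x, b x ∈ I0 R) ∧ ∀ x y, IsUnit (x - y) → ∃ a ∈ A, b x - b y = (x - y) * a

/-- Affine maps `R → I₀` with slope in `A`. -/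
def IsAffineIn {R : Type*} [CommRing R] (A : AddSubgroup R) (b : R → R) : Prop :=
  ∃ a ∈ A, ∃ c ∈ I0 R, ∀ x, b x = a * x + c

theorem HasSlopesIn.fwdDiff {R : Type*} [CommRing R] {A : AddSubgroup R} {b : R → R}
    (hb : HasSlopesIn A b) (t : R) : HasSlopesIn A (fwdDiff t b) := by
  refine ⟨fun x => sub_mem (hb.1 _) (hb.1 _), fun x y hxy => ?_⟩
  obtain ⟨a, ha, h⟩ := hb.2 (x + t) (y + t) (by rwa [add_sub_add_right_eq_sub])
  obtain ⟨a', ha', h'⟩ := hb.2 x y hxy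
  refine ⟨a - a', sub_mem ha ha', ?_⟩
  rw [_root_.fwdDiff, _root_.fwdDiff]
  linear_combination h - h'

theorem IsAffineIn.fwdDiff {R : Type*} [CommRing R] {A : AddSubgroup R} (hAI : ∀ a ∈ A, a ∈ I0 R)
    {b : R → R} (hb : IsAffineIn A b) (t : R) : IsAffineIn A (fwdDiff t b) := by
  obtain ⟨a, ha, c, hc, h⟩ := hb
  refine ⟨0, zero_mem _, t * a, Ideal.mul_mem_left _ _ (hAI a ha), fun x => ?_⟩
  rw [_root_.fwdDiff, h, h]
  ring

/-- Take n = p ^ N with p the residue characteristic and p ^ N = 0 in R. Since p kills I₀, only the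
two end terms of the binomial expansion survive; they are evaluated at the same point and cancel,
for p = 2 because 2 kills I₀. -/
theorem exists_fwdDiff_iterate_eq_zero (R : Type*) [CommRing R] [Finite R] [IsLocalRing R] :
    ∃ n, ∀ (t : R) (b : R → R), (∀ x, b x ∈ I0 R) → ∀ x, (fwdDiff t)^[n] b x = 0 := by
  have : Finite (R ⧸ IsLocalRing.maximalIdeal R) :=
    Finite.of_surjective _ Ideal.Quotient.mk_surjective
  let : Field (R ⧸ IsLocalRing.maximalIdeal R) := Ideal.Quotient.field _
  obtain ⟨p, hp⟩ := CharP.exists (R ⧸ IsLocalRing.maximalIdeal R)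
  have hpp : p.Prime := CharP.char_is_prime (R ⧸ IsLocalRing.maximalIdeal R) p
  have hpm : (p : R) ∈ IsLocalRing.maximalIdeal R := by
    rw [← Ideal.Quotient.eq_zero_iff_mem, map_natCast, CharP.cast_eq_zero]
  have hpu : ¬ IsUnit (p : R) := (IsLocalRing.mem_maximalIdeal _).1 hpm
  obtain ⟨N, hN⟩ : ∃ N, (p : R) ^ N = 0 := by
    obtain ⟨N, hN⟩ := IsArtinianRing.isNilpotent_jacobson_bot (R := R)
    rw [IsLocalRing.jacobson_eq_maximalIdeal _ bot_ne_top] at hN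
    exact ⟨N, by simpa [hN] using Ideal.pow_mem_pow hpm N⟩
  have hpn : ∀ k : ℤ, (p : ℤ) ∣ k → ∀ u ∈ I0 R, k • u = 0 := by
    rintro _ ⟨k, rfl⟩ u hu
    rw [mul_comm, mul_smul, natCast_zsmul, nsmul_eq_mul, mul_eq_zero_of_mem_I0 hu hpu, smul_zero]
  have hN0 : p ^ N ≠ 0 := pow_ne_zero _ hpp.ne_zero
  refine ⟨p ^ N, fun t b hb x => ?_⟩
  rw [fwdDiff_iter_eq_sum_shift, Finset.sum_range_succ, Finset.sum_eq_single 0]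
  · have e : p ^ N • t = 0 := by rw [nsmul_eq_mul, Nat.cast_pow, hN, zero_mul]
    rw [e, zero_smul, ← add_smul]
    refine hpn _ ?_ _ (by rw [add_zero]; exact hb _)
    simp only [tsub_zero, Nat.choose_zero_right, Nat.cast_one, mul_one, tsub_self, pow_zero,
      Nat.choose_self]
    rcases hpp.eq_two_or_odd' with rfl | hodd
    · rcases neg_one_pow_eq_or ℤ (2 ^ N) with h | h <;> rw [h] <;> norm_num
    · rw [(hodd.pow).neg_one_pow]; norm_num
  · intro k hk hk0
    refine hpn _ (Dvd.dvd.mul_left ?_ _) _ (hb _)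
    exact_mod_cast hpp.dvd_choose_pow hk0 (Finset.mem_range.1 hk).ne
  · intro h
    exact absurd (Finset.mem_range.2 (Nat.pos_of_ne_zero hN0)) h

/-- A counterexample can be replaced by one all of whose differences are affine. Symmetry of the
second differences then makes it additive up to a constant, where `addHom_eq_mul_of_mem` applies. -/
theorem HasSlopesIn.isAffineIn {R : Type*} [CommRing R] [Finite R] [IsLocalRing R]
    {A : AddSubgroup R} (hAI : ∀ a ∈ A, a ∈ I0 R) (hA : ∀ v, (∀ s, s * v ∈ A) → v = 0)
    {b : R → R} (hb : HasSlopesIn A b) : IsAffineIn A b := by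
  classical
  have := Fintype.ofFinite R
  obtain ⟨N, hN⟩ := exists_fwdDiff_iterate_eq_zero R
  by_contra hbA
  have exists_invariant : ∀ T : Finset R, ∃ b, HasSlopesIn A b ∧ ¬ IsAffineIn A b ∧
      ∀ t ∈ T, IsAffineIn A (_root_.fwdDiff t b) := by
    intro T
    induction T using Finset.induction_on with
    | empty => exact ⟨b, hb, hbA, by simp⟩
    | insert t T _ ih =>
      obtain ⟨b, hb, hbA, hT⟩ := ih
      have hex : ∃ n, IsAffineIn A ((_root_.fwdDiff t)^[n] b) :=
        ⟨N, 0, zero_mem _, 0, zero_mem _, fun x => by rw [hN t b hb.1]; ring⟩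
      have slopes : ∀ n, HasSlopesIn A ((_root_.fwdDiff t)^[n] b) := by
        intro n
        induction n with
        | zero => exact hb
        | succ n ih => rw [Function.iterate_succ_apply']; exact ih.fwdDiff t
      -- The last non-affine iterate of the difference operator is kept; difference operators
      -- commute, so the increments already treated stay affine.
      obtain ⟨m, hm⟩ : ∃ m, Nat.find hex = m + 1 :=
        Nat.exists_eq_succ_of_ne_zero fun h0 => hbA (by simpa [h0] using Nat.find_spec hex)
      refine ⟨(_root_.fwdDiff t)^[m] b, slopes m, Nat.find_min hex (by omega), fun s hs => ?_⟩
      rcases Finset.mem_insert.1 hs with rfl | hs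
      · have := Nat.find_spec hex
        rwa [hm, Function.iterate_succ_apply'] at this
      · have hcomm : Function.Commute (_root_.fwdDiff s : (R → R) → R → R) (_root_.fwdDiff t) := by
          intro f
          funext x
          simp only [_root_.fwdDiff]
          rw [add_right_comm]
          ring
        rw [(hcomm.iterate_right m).eq]
        generalize m = n
        induction n with
        | zero => exact hT s hs
        | succ n ih => rw [Function.iterate_succ_apply']; exact ih.fwdDiff hAI t
  obtain ⟨b, hb, hbA, hT⟩ := exists_invariant Finset.univ
  choose a ha c hc h using fun t => hT t (Finset.mem_univ t)
  simp only [_root_.fwdDiff] at h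
  -- The mixed second difference of `b` at 0 in the directions t and 1, computed in both orders.
  have hsymm : ∀ t, a t = a 1 * t := by
    intro t
    have h1 := h t 1
    have h2 := h t 0
    have h3 := h 1 t
    have h4 := h 1 0
    rw [zero_add] at h2 h4
    rw [add_comm] at h1
    linear_combination -h1 + h2 + h3 - h4
  have ha1 : a 1 = 0 := hA _ fun s => by
    rw [mul_comm, ← hsymm]
    exact ha s
  have hadd : ∀ x t, b (x + t) - b 0 = (b x - b 0) + (b t - b 0) := by
    intro x t
    have h1 := h t x
    have h2 := h t 0
    rw [hsymm, ha1] at h1 h2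
    rw [zero_add] at h2
    linear_combination h1 - h2
  have hlin := addHom_eq_mul_of_mem hA
    { toFun := fun x => b x - b 0, map_zero' := sub_self _, map_add' := hadd }
    (fun x => sub_mem (hb.1 x) (hb.1 0))
    (fun r hr => by simpa using hb.2 r 0 (by rwa [sub_zero]))
  obtain ⟨a', ha', h'⟩ := hb.2 1 0 (by simp)
  refine hbA ⟨a', ha', b 0, hb.1 0, fun x => ?_⟩
  have := hlin x
  simp only [AddMonoidHom.coe_mk, ZeroHom.coe_mk] at this
  linear_combination this + x * h'

/-! ### Maps preserving the scheme: quotients, rigidity, and lifting of homomorphisms. -/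

/-- Maps preserving all basis relations of `Cyc(K, R)`. -/
def IsCycMap {R : Type*} [CommRing R] (K : Subgroup Rˣ) (f : R → R) : Prop :=
  ∀ x y, ∃ k ∈ K, f x - f y = (x - y) * (k : R)

theorem IsCycMap.injective {R : Type*} [CommRing R] {K : Subgroup Rˣ} {f : R → R}
    (hf : IsCycMap K f) : Function.Injective f := by
  intro x y hxy
  obtain ⟨k, _, h⟩ := hf x y
  rw [hxy, sub_self, eq_comm, Units.mul_left_eq_zero] at h
  exact sub_eq_zero.1 h

theorem IsCycMap.sub_mem_iff {R : Type*} [CommRing R] {K : Subgroup Rˣ} {f : R → R}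
    (hf : IsCycMap K f) (I : Ideal R) {x y : R} : f x - f y ∈ I ↔ x - y ∈ I := by
  obtain ⟨k, _, h⟩ := hf x y
  rw [h, mul_comm]
  exact Ideal.unit_mul_mem_iff_mem I k.isUnit

theorem IsCycMap.mem_iff {R : Type*} [CommRing R] {K : Subgroup Rˣ} {f : R → R}
    (hf : IsCycMap K f) (h0 : f 0 = 0) (I : Ideal R) {x : R} : f x ∈ I ↔ x ∈ I := by
  simpa [h0] using hf.sub_mem_iff I (x := x) (y := 0)

theorem IsCycMap.translate {R : Type*} [CommRing R] {K : Subgroup Rˣ} {f : R → R}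
    (hf : IsCycMap K f) (t c : R) : IsCycMap K fun x => f (x + t) + c := by
  intro x y
  obtain ⟨k, hk, h⟩ := hf (x + t) (y + t)
  exact ⟨k, hk, by linear_combination h⟩

theorem IsCycMap.mul_left {R : Type*} [CommRing R] {K : Subgroup Rˣ} {f : R → R}
    (hf : IsCycMap K f) {k : Rˣ} (hk : k ∈ K) : IsCycMap K fun x => k * f x := by
  intro x y
  obtain ⟨l, hl, h⟩ := hf x y
  exact ⟨k * l, mul_mem hk hl, by rw [Units.val_mul]; linear_combination (k : R) * h⟩

theorem IsCycMap.conj {R : Type*} [CommRing R] {K : Subgroup Rˣ} {f : R → R}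
    (hf : IsCycMap K f) (r : Rˣ) : IsCycMap K fun x => ((r⁻¹ : Rˣ) : R) * f (r * x) := by
  intro x y
  obtain ⟨l, hl, h⟩ := hf (r * x) (r * y)
  exact ⟨l, hl, by linear_combination ((r⁻¹ : Rˣ) : R) * h + (x - y) * (l : R) * r.inv_mul⟩

/-- The map induced on the quotient by an ideal. -/
theorem IsCycMap.exists_quotient {R : Type*} [CommRing R] {K : Subgroup Rˣ} {f : R → R}
    (hf : IsCycMap K f) (I : Ideal R) : ∃ g : R ⧸ I → R ⧸ I, IsCycMap (imageQuot I K) g ∧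
      ∀ x, g (Ideal.Quotient.mk I x) = Ideal.Quotient.mk I (f x) := by
  have hwd : ∀ x y : R, Submodule.quotientRel I x y →
      Ideal.Quotient.mk I (f x) = Ideal.Quotient.mk I (f y) := by
    intro x y hxy
    rw [Submodule.quotientRel_def] at hxy
    exact Ideal.Quotient.eq.2 ((hf.sub_mem_iff I).2 hxy)
  refine ⟨Quotient.lift (fun x => Ideal.Quotient.mk I (f x)) hwd, ?_, fun x => rfl⟩
  intro x y
  obtain ⟨x, rfl⟩ := Ideal.Quotient.mk_surjective x
  obtain ⟨y, rfl⟩ := Ideal.Quotient.mk_surjective y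
  obtain ⟨k, hk, h⟩ := hf x y
  refine ⟨_, Subgroup.mem_map_of_mem _ hk, ?_⟩
  change Ideal.Quotient.mk I (f x) - Ideal.Quotient.mk I (f y) =
    (Ideal.Quotient.mk I x - Ideal.Quotient.mk I y) * Ideal.Quotient.mk I k
  rw [← map_sub, h, map_mul, map_sub]

/-- Two maps preserving the scheme that agree modulo `I₀` differ by an affine map. -/
theorem IsCycMap.eq_affine_of_sub_mem_I0 {R : Type*} [CommRing R] [Finite R] [IsLocalRing R]
    {K : Subgroup Rˣ} (hK : IsPure K) {f g : R → R} (hf : IsCycMap K f) (hg : IsCycMap K g)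
    (hfg : ∀ x, f x - g x ∈ I0 R) :
    ∃ a ∈ principalPart K, ∃ c, ∀ x, f x = (1 + a) * g x + c := by
  let e := Equiv.ofBijective g (Finite.injective_iff_bijective.1 hg.injective)
  have he : ∀ x, g (e.symm x) = x := e.apply_symm_apply
  have he' : ∀ x, e.symm (g x) = x := e.symm_apply_apply
  -- The deviation of f ∘ g⁻¹ from the identity: its slope is l⁻¹k - 1, with k and l the multipliers
  -- of f and g.
  have hb : HasSlopesIn (principalPart K) fun x => f (e.symm x) - x := by
    have hI : ∀ x, f (e.symm x) - x ∈ I0 R := fun x => by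
      simpa only [he] using hfg (e.symm x)
    refine ⟨hI, fun x y hxy => ?_⟩
    obtain ⟨k, hk, h⟩ := hf (e.symm x) (e.symm y)
    obtain ⟨l, hl, h'⟩ := hg (e.symm x) (e.symm y)
    rw [he, he] at h'
    have key : f (e.symm x) - x - (f (e.symm y) - y) =
        (x - y) * (((l⁻¹ * k : Rˣ) : R) - 1) := by
      rw [Units.val_mul]
      linear_combination h - ((l⁻¹ : Rˣ) : R) * k * h' -
        (e.symm x - e.symm y) * (k : R) * l.mul_inv
    refine ⟨_, ⟨?_, l⁻¹ * k, mul_mem (inv_mem hl) hk, by ring⟩, key⟩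
    have := sub_mem (hI x) (hI y)
    rw [key] at this
    exact (Ideal.unit_mul_mem_iff_mem _ hxy).1 this
  obtain ⟨a, ha, c, _, h⟩ := hb.isAffineIn (fun a (ha : a ∈ principalPart K) => ha.1)
    (fun v => eq_zero_of_forall_mul_mem_principalPart hK)
  refine ⟨a, ha, c, fun x => ?_⟩
  have := h (g x)
  simp only [he'] at this
  linear_combination this

/-- A normalized map preserving the scheme that induces a ring homomorphism modulo `I₀` is a ring
homomorphism. -/
theorem IsCycMap.map_add_and_map_mul {R : Type*} [CommRing R] [Finite R] [IsLocalRing R]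
    {K : Subgroup Rˣ} (hK : IsPure K) {f : R → R} (hf : IsCycMap K f) (h0 : f 0 = 0) (h1 : f 1 = 1)
    (hadd : ∀ x y, f (x + y) - (f x + f y) ∈ I0 R)
    (hmul : ∀ x y, f (x * y) - f x * f y ∈ I0 R) :
    (∀ x y, f (x + y) = f x + f y) ∧ ∀ x y, f (x * y) = f x * f y := by
  have hsurj : Function.Surjective f := Finite.injective_iff_surjective.1 hf.injective
  have add : ∀ x y, f (x + y) = f x + f y := by
    have : ∀ y, ∃ a ∈ principalPart K, ∀ x, f (x + y) = f x + f y + a * f x := by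
      intro y
      obtain ⟨a, ha, c, h⟩ := IsCycMap.eq_affine_of_sub_mem_I0 hK (hf.translate y 0)
        (g := fun x => f (x + 0) + f y) (hf.translate 0 (f y)) (fun x => by simpa using hadd x y)
      refine ⟨a, ha, fun x => ?_⟩
      have e := h x
      have e0 := h 0
      simp only [add_zero, zero_add, h0] at e e0
      linear_combination e - e0
    choose a ha h using this
    -- The expression f (x + y) is symmetric; evaluate at the pairs (1, y) and (y, 1). As f is onto,
    -- `a 1` then generates an ideal inside the principal part.
    have hsymm : ∀ y, a y = a 1 * f y := by
      intro y
      have e := h y 1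
      have e' := h 1 y
      rw [add_comm, h1] at e
      rw [h1] at e'
      linear_combination e' - e
    have ha1 : a 1 = 0 := eq_zero_of_forall_mul_mem_principalPart hK fun s => by
      obtain ⟨y, rfl⟩ := hsurj s
      rw [mul_comm, ← hsymm]
      exact ha y
    intro x y
    rw [h, hsymm, ha1]
    ring
  have mul_unit : ∀ (r : Rˣ) x, f (r * x) = f r * f x := by
    intro r x
    obtain ⟨k, hk, hfr⟩ := hf r 0
    rw [h0, sub_zero, sub_zero] at hfr
    -- With f r = rk, the maps r⁻¹ f (r x) and k f x agree modulo I₀, and also exactly at 0 and 1,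
    -- so they coincide.
    obtain ⟨a, _, c, h⟩ := IsCycMap.eq_affine_of_sub_mem_I0 hK (hf.conj r) (hf.mul_left hk)
      (fun x => by
        have := Ideal.mul_mem_left _ ((r⁻¹ : Rˣ) : R) (hmul r x)
        convert this using 1
        rw [hfr]
        linear_combination (k : R) * f x * r.inv_mul)
    have e0 := h 0
    have e1 := h 1
    have ex := h x
    simp only [mul_zero, mul_one, h0, h1, zero_add] at e0 e1
    have hak : a * k = 0 := by
      rw [hfr] at e1
      linear_combination -e1 + (k : R) * r.inv_mul + e0
    have := r.mul_inv
    rw [hfr]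
    linear_combination (r : R) * ex - f (r * x) * this + (r : R) * f x * hak - (r : R) * e0
  refine ⟨add, fun x y => ?_⟩
  rcases IsLocalRing.isUnit_or_isUnit_one_sub_self x with hx | hx
  · exact mul_unit hx.unit y
  -- For a nonunit x, multiplicativity at the unit 1 - x is transferred by additivity.
  · have e := mul_unit hx.unit y
    have e1 := add (1 - x) x
    have e2 := add ((1 - x) * y) (x * y)
    rw [IsUnit.unit_spec] at e
    rw [show (1 - x) * y + x * y = y by ring, e] at e2
    rw [sub_add_cancel, h1] at e1
    linear_combination -e2 + f y * e1

/-! ### Base case: the quotient by I₀ is a field. -/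

/-- The last nonzero power of the maximal ideal lies in I₀. -/
theorem exists_mem_I0_ne_zero {R : Type*} [CommRing R] [Finite R] [IsLocalRing R]
    (hR : ¬ IsField R) : ∃ u ∈ I0 R, u ≠ 0 := by
  classical
  have hex : ∃ N, IsLocalRing.maximalIdeal R ^ N = ⊥ := by
    obtain ⟨N, hN⟩ := IsArtinianRing.isNilpotent_jacobson_bot (R := R)
    rw [IsLocalRing.jacobson_eq_maximalIdeal _ bot_ne_top] at hN
    exact ⟨N, hN⟩
  have hspec := Nat.find_spec hex
  have hlt := fun m => Nat.find_min hex (m := m)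
  rcases hn : Nat.find hex with _ | _ | n
  · rw [hn, pow_zero, Ideal.one_eq_top] at hspec
    exact absurd hspec.symm bot_ne_top
  · rw [hn, zero_add, pow_one] at hspec
    exact absurd (IsLocalRing.isField_iff_maximalIdeal_eq.2 hspec) hR
  · obtain ⟨u, hu, hu0⟩ := Submodule.exists_mem_ne_zero_of_ne_bot (hlt (n + 1) (by omega))
    refine ⟨u, mem_I0_iff.2 ⟨Ideal.pow_le_self n.succ_ne_zero hu, fun y hy => ?_⟩, hu0⟩
    have := Ideal.mul_mem_mul hu hy
    rw [← pow_succ, ← hn, hspec] at this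
    exact this

theorem isUnit_of_map_ne_zero {R F : Type*} [CommRing R] [IsLocalRing R] [Field F] {π : R →+* F}
    (hπ : Function.Surjective π) {r : R} (hr : π r ≠ 0) : IsUnit r := by
  by_contra hu
  have := RingHom.ker_isMaximal_of_surjective π hπ
  refine hr (RingHom.mem_ker.1 ?_)
  rw [IsLocalRing.eq_maximalIdeal this]
  exact (IsLocalRing.mem_maximalIdeal r).2 hu

section Base

variable {R F : Type*} [CommRing R] [Finite R] [IsLocalRing R] [Field F] {K : Subgroup Rˣ}
  {π : R →+* F} {f : R → R} {h : F → F}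

/-- For s = π r, r a unit, and u ∈ I₀, comparing f at u, r⁻¹ and 0 gives 1 + (r u - g f u) ∈ K,
where g lifts h(s⁻¹)⁻¹. Adding such relations cancels the r u terms; if additivity failed, a unit
multiple of f(I₀) = I₀ would lie in the principal part, contradicting purity. -/
theorem IsCycMap.inv_additive (hR : ¬ IsField R) (hK : IsPure K) (hπ : Function.Surjective π)
    (hker : ∀ x, π x = 0 ↔ x ∈ I0 R) (hf : IsCycMap K f) (h0 : f 0 = 0)
    (hh : ∀ x, h (π x) = π (f x)) (s t : F) :
    (h (s + t)⁻¹)⁻¹ = (h s⁻¹)⁻¹ + (h t⁻¹)⁻¹ := by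
  have lift : ∀ s, ∃ r g, π r = s ∧ π g = (h s⁻¹)⁻¹ ∧
      ∀ u ∈ I0 R, r * u - g * f u ∈ principalPart K := by
    intro s
    rcases eq_or_ne s 0 with rfl | hs
    · have : h 0 = 0 := by simpa [h0] using hh 0
      exact ⟨0, 0, map_zero π, by simp [this], fun u _ => by
        rw [zero_mul, zero_mul, sub_zero]; exact zero_mem _⟩
    obtain ⟨r, rfl⟩ := hπ s
    obtain ⟨r, rfl⟩ := isUnit_of_map_ne_zero hπ hs
    obtain ⟨k, hk, hfr⟩ := hf ((r⁻¹ : Rˣ) : R) 0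
    rw [h0, sub_zero, sub_zero] at hfr
    refine ⟨r, r * ((k⁻¹ : Rˣ) : R), rfl, ?_, fun u hu => ?_⟩
    · have e : (π r)⁻¹ = π ((r⁻¹ : Rˣ) : R) :=
        inv_eq_of_mul_eq_one_right (by rw [← map_mul, r.mul_inv, map_one])
      rw [e, hh, hfr]
      refine eq_inv_of_mul_eq_one_left ?_
      rw [← map_mul, ← map_one π]
      congr 1
      linear_combination (k : R) * ((k⁻¹ : Rˣ) : R) * r.mul_inv + k.mul_inv
    · obtain ⟨l, hl, hfu⟩ := hf u ((r⁻¹ : Rˣ) : R)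
      have hfuI : f u ∈ I0 R := (hf.mem_iff h0 _).2 hu
      have e1 : ((k⁻¹ : Rˣ) : R) * l - 1 =
          r * ((k⁻¹ : Rˣ) : R) * l * u - r * ((k⁻¹ : Rˣ) : R) * f u := by
        linear_combination (r : R) * ((k⁻¹ : Rˣ) : R) * hfu +
          (r : R) * ((k⁻¹ : Rˣ) : R) * hfr + ((k⁻¹ : Rˣ) : R) * k * r.mul_inv + k.inv_mul
          - ((k⁻¹ : Rˣ) : R) * l * r.mul_inv
      have e1I : ((k⁻¹ : Rˣ) : R) * l - 1 ∈ I0 R := by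
        rw [e1]
        exact sub_mem (Ideal.mul_mem_left _ _ hu) (Ideal.mul_mem_left _ _ hfuI)
      have e2 := mul_eq_zero_of_mem_I0_of_mem_I0 e1I hu
      refine ⟨sub_mem (Ideal.mul_mem_left _ _ hu) (Ideal.mul_mem_left _ _ hfuI), k⁻¹ * l,
        mul_mem (inv_mem hk) hl, ?_⟩
      rw [Units.val_mul]
      linear_combination e1 + (r : R) * e2
  obtain ⟨r₁, g₁, hr₁, hg₁, H₁⟩ := lift s
  obtain ⟨r₂, g₂, hr₂, hg₂, H₂⟩ := lift t
  obtain ⟨r₃, g₃, hr₃, hg₃, H₃⟩ := lift (s + t)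
  rw [← hg₁, ← hg₂, ← hg₃]
  by_contra hne
  have hD : r₁ + r₂ - r₃ ∈ I0 R := by
    rw [← hker, map_sub, map_add, hr₁, hr₂, hr₃, sub_self]
  have hE : ∀ u ∈ I0 R, (g₁ + g₂ - g₃) * f u ∈ principalPart K := by
    intro u hu
    have := sub_mem (H₃ u hu) (add_mem (H₁ u hu) (H₂ u hu))
    convert this using 1
    linear_combination mul_eq_zero_of_mem_I0_of_mem_I0 hD hu
  have hEu : IsUnit (g₁ + g₂ - g₃) := isUnit_of_map_ne_zero hπ (by
    rw [map_sub, map_add]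
    exact fun h' => hne (sub_eq_zero.1 h').symm)
  obtain ⟨e, he⟩ := hEu.exists_right_inv
  obtain ⟨v, hv, hv0⟩ := exists_mem_I0_ne_zero hR
  refine hv0 (eq_zero_of_forall_mul_mem_principalPart hK fun c => ?_)
  obtain ⟨u, hu⟩ := Finite.injective_iff_surjective.1 hf.injective (e * (c * v))
  have := hE u ((hf.mem_iff h0 _).1 (by
    rw [hu]; exact Ideal.mul_mem_left _ _ (Ideal.mul_mem_left _ _ hv)))
  rwa [hu, ← mul_assoc, he, one_mul] at this

theorem IsCycMap.map_add_and_map_mul_of_field (hR : ¬ IsField R) (hK : IsPure K)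
    (hπ : Function.Surjective π) (hker : ∀ x, π x = 0 ↔ x ∈ I0 R) (hf : IsCycMap K f)
    (h0 : f 0 = 0) (h1 : f 1 = 1) (hh : ∀ x, h (π x) = π (f x)) :
    (∀ x y, h (x + y) = h x + h y) ∧ ∀ x y, h (x * y) = h x * h y := by
  have : Finite F := Finite.of_surjective π hπ
  have hinj : Function.Injective h := by
    intro x y hxy
    obtain ⟨x, rfl⟩ := hπ x
    obtain ⟨y, rfl⟩ := hπ y
    rw [hh, hh, ← sub_eq_zero, ← map_sub, hker, hf.sub_mem_iff, ← hker, map_sub] at hxy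
    exact sub_eq_zero.1 hxy
  have H0 : h 0 = 0 := by simpa [h0] using hh 0
  have H1 : h 1 = 1 := by simpa [h1] using hh 1
  have hG := hf.inv_additive hR hK hπ hker h0 hh
  -- The same result for f (x + 1) - 1, again normalized at 0, gives the hypothesis of Hua's
  -- identity around 1.
  have hH := (hf.translate 1 (-1)).inv_additive (h := fun y => h (1 + y) - 1) hR hK hπ hker
    (by simp [h1]) (fun x => by
      rw [← map_one π, ← map_add, hh, add_comm, map_add, map_neg, sub_eq_add_neg])
  have hadd := hua_additive hinj H0 H1 hG hH
  exact ⟨hadd, hua_multiplicative hinj H0 H1 hadd hG⟩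

end Base

/-! ### Induction along R → R/I₀ and the main theorem. -/

theorem isLocalRing_quotient_I0 (R : Type*) [CommRing R] [IsLocalRing R] :
    IsLocalRing (R ⧸ I0 R) := by
  have : Nontrivial (R ⧸ I0 R) := Ideal.Quotient.nontrivial_iff.2 fun h =>
    not_isUnit_of_mem_I0 ((Ideal.eq_top_iff_one _).1 h) isUnit_one
  exact IsLocalRing.of_surjective' _ Ideal.Quotient.mk_surjective

theorem IsStronglyPure.map_add_and_map_mul {R : Type*} [CommRing R] {K : Subgroup Rˣ}
    (hK : IsStronglyPure K) : Finite R → IsLocalRing R → ¬ IsField R →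
      ∀ f : R → R, IsCycMap K f → f 0 = 0 → f 1 = 1 →
        (∀ x y, f (x + y) = f x + f y) ∧ ∀ x y, f (x * y) = f x * f y := by
  induction hK with
  | @intro R _ K pure _ ih =>
    intro _ _ hR f hf h0 h1
    obtain ⟨g, hg, hgf⟩ := hf.exists_quotient (I0 R)
    have hg' : (∀ x y, g (x + y) = g x + g y) ∧ ∀ x y, g (x * y) = g x * g y := by
      by_cases hF : IsField (R ⧸ I0 R)
      · have := Ideal.Quotient.maximal_of_isField _ hF
        let : Field (R ⧸ I0 R) := Ideal.Quotient.field _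
        exact hf.map_add_and_map_mul_of_field hR pure Ideal.Quotient.mk_surjective
          (fun x => Ideal.Quotient.eq_zero_iff_mem) h0 h1 hgf
      · exact ih hR (Finite.of_surjective _ Ideal.Quotient.mk_surjective)
          (isLocalRing_quotient_I0 R) hF g hg
          (by rw [← map_zero (Ideal.Quotient.mk (I0 R)), hgf, h0])
          (by rw [← map_one (Ideal.Quotient.mk (I0 R)), hgf, h1])
    refine hf.map_add_and_map_mul pure h0 h1 (fun x y => ?_) (fun x y => ?_)
    · rw [← Ideal.Quotient.eq, map_add, ← hgf, ← hgf, ← hgf, map_add, hg'.1]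
    · rw [← Ideal.Quotient.eq, map_mul, ← hgf, ← hgf, ← hgf, map_mul, hg'.2]

/-- A normalized map preserving the scheme that is trivial modulo the radical is trivial. -/
theorem IsStronglyPure.eq_self_of_sub_mem {R : Type*} [CommRing R] {K : Subgroup Rˣ}
    (hK : IsStronglyPure K) : Finite R → ∀ _ : IsLocalRing R, ¬ IsField R →
      ∀ f : R → R, IsCycMap K f → f 0 = 0 → f 1 = 1 →
        (∀ x, f x - x ∈ IsLocalRing.maximalIdeal R) → ∀ x, f x = x := by
  induction hK with
  | @intro R _ K pure _ ih =>
    intro _ _ hR f hf h0 h1 hfm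
    have hI : ∀ x, f x - x ∈ I0 R := by
      by_cases hF : IsField (R ⧸ I0 R)
      -- If the quotient is a field, then I₀ is the maximal ideal and the assumption is already the
      -- congruence needed.
      · rwa [IsLocalRing.eq_maximalIdeal (Ideal.Quotient.maximal_of_isField _ hF)]
      obtain ⟨g, hg, hgf⟩ := hf.exists_quotient (I0 R)
      have hloc := isLocalRing_quotient_I0 R
      intro x
      rw [← Ideal.Quotient.eq, ← hgf]
      refine ih hR (Finite.of_surjective _ Ideal.Quotient.mk_surjective) hloc hF g hg
        (by rw [← map_zero (Ideal.Quotient.mk (I0 R)), hgf, h0])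
        (by rw [← map_one (Ideal.Quotient.mk (I0 R)), hgf, h1]) (fun y => ?_) _
      obtain ⟨y, rfl⟩ := Ideal.Quotient.mk_surjective y
      rw [hgf, ← map_sub, IsLocalRing.mem_maximalIdeal]
      intro hu
      have : IsLocalHom (Ideal.Quotient.mk (I0 R)) :=
        IsLocalHom.of_surjective _ Ideal.Quotient.mk_surjective
      exact (IsLocalRing.mem_maximalIdeal _).1 (hfm y) (isUnit_of_map_unit _ _ hu)
    have hid : IsCycMap K fun x : R => x := fun x y => ⟨1, one_mem _, by simp⟩
    obtain ⟨a, _, c, h⟩ := hf.eq_affine_of_sub_mem_I0 pure hid hI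
    have e0 := h 0
    have e1 := h 1
    intro x
    rw [h0] at e0
    rw [h1] at e1
    rw [h]
    linear_combination (x - 1) * e0 - x * e1

open scoped Pointwise in
theorem isCycMap_of_mem_schemeAut {R : Type*} [CommRing R] {K : Subgroup Rˣ} {f : Equiv.Perm R}
    (hf : f ∈ schemeAut (cyc K)) : IsCycMap K f := by
  intro x y
  have hS : ({p | p.2 - p.1 ∈ (x - y) • unitSet K} : Set (R × R)) ∈ cyc K := ⟨x - y, rfl⟩
  have hmem : (f y, f x) ∈ ({p | p.2 - p.1 ∈ (x - y) • unitSet K} : Set (R × R)) := by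
    rw [← hf _ hS]
    exact ⟨(y, x), ⟨1, ⟨1, one_mem _, rfl⟩, by simp⟩, rfl⟩
  obtain ⟨_, ⟨k, hk, rfl⟩, h⟩ := hmem
  exact ⟨k, hk, h.symm⟩

end CycScheme

theorem mainTheorem3 {R : Type*} [CommRing R] [Finite R] [IsLocalRing R] (hR : ¬ IsField R)
    (K : Subgroup Rˣ) (hK : CycScheme.IsStronglyPure K) :
    CycScheme.IsNormalScheme (CycScheme.cyc K) ∧
      Function.Injective (CycScheme.residueAutHom (CycScheme.cyc K)) := by
  constructor
  · intro f hf
    have hf := CycScheme.isCycMap_of_mem_schemeAut hf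
    obtain ⟨k, hk, hfk⟩ := hf 1 0
    rw [sub_zero, one_mul] at hfk
    -- Subtracting f 0 and dividing by k = f 1 - f 0 normalizes f; the result is the ring
    -- automorphism σ with f x = k σ x + f 0.
    have hg : CycScheme.IsCycMap K fun x => ((k⁻¹ : Rˣ) : R) * (f (x + 0) + -f 0) :=
      (hf.translate 0 (-f 0)).mul_left (inv_mem hk)
    obtain ⟨hadd, hmul⟩ := hK.map_add_and_map_mul inferInstance inferInstance hR _ hg (by simp)
      (by rw [add_zero, ← sub_eq_add_neg, hfk, k.inv_mul])
    let σ : R →+* R :=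
      { toFun := fun x => ((k⁻¹ : Rˣ) : R) * (f (x + 0) + -f 0)
        map_zero' := by simp
        map_one' := by rw [add_zero, ← sub_eq_add_neg, hfk, k.inv_mul]
        map_add' := hadd
        map_mul' := hmul }
    refine ⟨k, f 0, RingEquiv.ofBijective σ (Finite.injective_iff_bijective.1 hg.injective),
      fun x => ?_⟩
    change f x = k * (((k⁻¹ : Rˣ) : R) * (f (x + 0) + -f 0)) + f 0
    rw [k.mul_inv_cancel_left, add_zero]
    ring
  · rw [injective_iff_map_eq_one]
    rintro ⟨σ, hσ⟩ h
    refine Subtype.ext (RingEquiv.ext fun x => ?_)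
    refine hK.eq_self_of_sub_mem inferInstance inferInstance hR σ
      (CycScheme.isCycMap_of_mem_schemeAut hσ) (map_zero σ) (map_one σ) (fun y => ?_) x
    have e : IsLocalRing.residue R (σ y) = IsLocalRing.residue R y :=
      congrArg (fun τ => τ.1 (IsLocalRing.residue R y)) h
    rwa [← IsLocalRing.residue_eq_zero_iff, map_sub, sub_eq_zero]
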